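/- Let $\mathbb H=\{z\in\mathbb C:\operatorname{Re} z>0\}$. A *tract* is an unbounded Jordan domain $T\subset\mathbb C$ (a domain whose boundary in the Riemann sphere is a Jordan curve) whose real parts are unbounded from above and whose translates $T+2\pi i n$ ($n\in\mathbb Z$) have pairwise disjoint closures in $\mathbb C$. **Theorem 6.1 (No Curve To Infinity).** Let $T\subset\mathbb H$ be a tract, and let $F_0\colon T\to\mathbb H$ be a Riemann map (conformal isomorphism), extended continuously to the closure of $T$ in the Riemann sphere by Carathéodory's theorem. Let $H<2\pi$, and suppose that the following hold: 1. $F_0(\infty)=\infty$; 2. $|\operatorname{Im} z-\operatorname{Im} z'|<H$ for all $z,z'\in T$; 3. there are pairwise disjoint hyperbolic geodesics $C_k,C'_k\subset T$, $k=0,1,2,\dots$, such that $F_0(C_k)$ and $F_0(C'_k)$ are the semicircles in $\mathbb H$ centered at $0$ with radii $\rho_{k+1}$ and $\rho'_{k+1}$, respectively, where $0<\rho_1<\rho'_1<\rho_2<\rho'_2<\cdots$; 4. $\rho_k+H<\rho'_k/2$ and $\rho'_k+H<\rho_{k+1}/2$ for all $k\ge1$; 5. for all $k\ge1$, all points of $C_k$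 and $C'_k$ have real parts strictly between $\rho'_k+H$ and $\rho_{k+1}/2$; 6. for all $k\ge1$, all points in the unbounded component of $T\setminus C'_k$ have real parts greater than $\rho'_k$; 7. for all $k\ge1$, every curve in $T$ that connects $C_k$ to $C'_k$ intersects the line $\{z\in\mathbb C:\operatorname{Re} z=\rho_k/2\}$. Put $T_n:=T+2\pi i n$ for $n\in\mathbb Z$ and $\mathcal T:=\bigcup_{n\in\mathbb Z}T_n$, and define $F\colon\mathcal T\to\mathbb H$ by $F(z):=F_0(z-2\pi i n)$ for $z\in T_n$. Then the set $$J:=\{z\in\mathcal T:\ F^{\circ k}(z)\in\mathcal T\text{ for all }k\ge0\}$$ contains no curve to $\infty$; that is, there is no continuous $\gamma\colon[0,\infty)\to J$ with $|\gamma(t)|\to\infty$ as $t\to\infty$. -/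

import Mathlib

open Set Filter Topology Bornology

noncomputable section

/-- The right half-plane `ℍ = {z : Re z > 0}`. -/
def rightHalfPlane : Set ℂ := {z | 0 < z.re}

/-- A Jordan domain: a domain in `ℂ` whose boundary in the Riemann sphere is a Jordan curve. -/
def IsJordanDomain (U : Set ℂ) : Prop :=
  IsOpen U ∧ IsConnected U ∧
    ∃ g : Circle → OnePoint ℂ, Continuous g ∧ Function.Injective g ∧
      range g = frontier ((fun z : ℂ => (z : OnePoint ℂ)) '' U)

/-- The vertical translate `T + 2πi n`. -/
def verticalTranslate (T : Set ℂ) (n : ℤ) : Set ℂ :=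
  (fun z : ℂ => z + 2 * Real.pi * Complex.I * n) '' T

/-- A tract: an unbounded Jordan domain whose real parts are unbounded from above and whose
`2πi ℤ`-translates have pairwise disjoint closures. -/
structure IsTract (T : Set ℂ) : Prop where
  jordan : IsJordanDomain T
  unbounded : ¬ IsBounded T
  re_unbounded : ¬ BddAbove (Complex.re '' T)
  disjoint_closures : Pairwise fun m n : ℤ =>
    Disjoint (closure (verticalTranslate T m)) (closure (verticalTranslate T n))

/-- A Riemann map (conformal isomorphism) from `U` onto the right half-plane. -/
def IsRiemannMap (U : Set ℂ) (f : ℂ → ℂ) : Prop :=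
  DifferentiableOn ℂ f U ∧ BijOn f U rightHalfPlane

/-- The continuous extension of `f : U → ℂ` to the closure of `U` in the Riemann sphere takes the
value `∞` at `∞`, that is, `f z → ∞` as `z → ∞` within `U`. -/
def FixesInfinity (U : Set ℂ) (f : ℂ → ℂ) : Prop :=
  Tendsto f (cobounded ℂ ⊓ 𝓟 U) (cobounded ℂ)

/-- `C ⊆ U` is mapped by `f` onto the semicircle in `ℍ` centered at `0` of radius `r`.
When `f : U → ℍ` is a conformal isomorphism, `f` is an isometry of the hyperbolic metrics, and
these semicircles are hyperbolic geodesics of `ℍ`; hence such a `C` is a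
hyperbolic geodesic of `U`, and it is determined by `r`. -/
def IsVerticalGeodesic (U : Set ℂ) (f : ℂ → ℂ) (r : ℝ) (C : Set ℂ) : Prop :=
  C ⊆ U ∧ f '' C = {w : ℂ | w ∈ rightHalfPlane ∧ ‖w‖ = r}

/-- The union of the unbounded connected components of `S`. -/
def unboundedComponents (S : Set ℂ) : Set ℂ :=
  {z | z ∈ S ∧ ¬ IsBounded (connectedComponentIn S z)}

/-- The union `𝒯` of all translates `T + 2πi n`. -/
def allTranslates (T : Set ℂ) : Set ℂ := ⋃ n : ℤ, verticalTranslate T n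

open Classical in
/-- The map `F` on `𝒯` given by `F z = F₀ (z - 2πi n)` for `z ∈ T + 2πi n`
(the value `0` outside `𝒯` plays no role). -/
def periodicExtension (T : Set ℂ) (F₀ : ℂ → ℂ) (z : ℂ) : ℂ :=
  if h : ∃ n : ℤ, z ∈ verticalTranslate T n then
    F₀ (z - 2 * Real.pi * Complex.I * (h.choose : ℤ))
  else 0

theorem periodicExtension_eq {T : Set ℂ} (hT : IsTract T) (F₀ : ℂ → ℂ) {n : ℤ} {z : ℂ}
    (hz : z ∈ verticalTranslate T n) :
    periodicExtension T F₀ z = F₀ (z - 2 * Real.pi * Complex.I * n) := by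
  have h : ∃ n : ℤ, z ∈ verticalTranslate T n := ⟨n, hz⟩
  have hn : h.choose = n := by
    by_contra hne
    exact disjoint_left.1 (hT.disjoint_closures hne) (subset_closure h.choose_spec)
      (subset_closure hz)
  rw [periodicExtension, dif_pos h, hn]

/-- The set of points whose whole forward orbit under `F` stays in the domain `D` of `F`. -/
def juliaSet (D : Set ℂ) (F : ℂ → ℂ) : Set ℂ := {z | ∀ k : ℕ, F^[k] z ∈ D}

/-- `S` contains a curve to `∞`: a continuous `γ : [0, ∞) → S` with `γ t → ∞` as `t → ∞`. -/
def ContainsCurveToInfinity (S : Set ℂ) : Prop :=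
  ∃ γ : ℝ → ℂ, ContinuousOn γ (Ici 0) ∧ (∀ t, 0 ≤ t → γ t ∈ S) ∧ Tendsto γ atTop (cobounded ℂ)

end

/-! Let Γ_k be the k-th iterate of a hypothetical curve. It tends to ∞ inside one translate of T. A
crossing at level k is a pair of times at which |Γ_k| is at most ρ_{m+k+1} and at least ρ'_{m+k+1}.
The times of a crossing at level j+1 enclose a passage of Γ_j from a translate of C_{m+j+1} to the
same translate of C'_{m+j+1}. This passage must return to real part ρ_{m+j+1}/2, where its modulus
is below ρ_{m+j+1}, while both its ends have modulus above ρ'_{m+j+1}. Hence it contains two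
crossings at level j (`false_of_doubling_crossings`). A crossing at level j thus contains 2^j
non-overlapping crossings of the original curve, which tends to ∞ and so has a bounded number of
them. Yet crossings exist at every level, since |Γ_k(0)| ≤ ρ'_{m+k} for all k. -/

/-- No sequence of functions on `[0, ∞)` has crossings at every level if a crossing at level
`j + 1` always contains two consecutive crossings at level `j`, and the function at level `0` is
continuous and tends to infinity. -/
theorem false_of_doubling_crossings (g : ℕ → ℝ → ℝ) (r r' : ℕ → ℝ) (hr : r 0 < r' 0)
    (hcont : ContinuousOn (g 0) (Ici 0)) (hlim : Tendsto (g 0) atTop atTop)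
    (hex : ∀ j, ∃ a b, 0 ≤ a ∧ 0 ≤ b ∧ g j a ≤ r j ∧ r' j ≤ g j b)
    (hsplit : ∀ j a b, 0 ≤ a → 0 ≤ b → g (j + 1) a ≤ r (j + 1) → r' (j + 1) ≤ g (j + 1) b →
      ∃ a' ∈ uIcc a b, ∃ b' ∈ uIcc a b, ∃ c ∈ uIcc a' b',
        r' j ≤ g j a' ∧ g j c ≤ r j ∧ r' j ≤ g j b') : False := by
  obtain ⟨B, hB⟩ := eventually_atTop.1 (hlim.eventually_gt_atTop (r 0))
  have hunif : UniformContinuousOn (g 0) (Icc 0 (B + 1)) :=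
    isCompact_Icc.uniformContinuousOn_of_continuous (hcont.mono Icc_subset_Ici_self)
  obtain ⟨δ, hδ, hclose⟩ := Metric.uniformContinuousOn_iff.1 hunif (r' 0 - r 0) (by linarith)
  -- Time is clipped at `B + 1`. The low end of a level-`0` crossing lies before `B`, so its clipped
  -- length is at least `δ` if the high end comes by time `B + 1`, and at least `1` otherwise.
  set φ : ℝ → ℝ := fun t => min t (B + 1) with hφ
  have hmono : Monotone φ := fun s t hst => min_le_min_right _ hst
  have key : ∀ j a b, 0 ≤ a → 0 ≤ b → g j a ≤ r j → r' j ≤ g j b →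
      2 ^ j * min δ 1 ≤ |φ a - φ b| := by
    intro j
    induction j with
    | zero =>
      intro a b ha hb hga hgb
      have haB : a < B := by
        by_contra! h
        exact absurd (hB a h) (not_lt.2 hga)
      have hφa : φ a = a := min_eq_left (by linarith)
      rcases le_total b (B + 1) with hbB | hbB
      · have hφb : φ b = b := min_eq_left hbB
        rw [hφa, hφb, pow_zero, one_mul]
        by_contra! h
        have h1 : dist a b < δ := h.trans_le (min_le_left _ _)
        have h2 := hclose a ⟨ha, by linarith⟩ b ⟨hb, hbB⟩ h1
        rw [Real.dist_eq, abs_lt] at h2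
        linarith [h2.1]
      · have hφb : φ b = B + 1 := min_eq_right hbB
        rw [hφa, hφb, pow_zero, one_mul]
        refine (min_le_right _ _).trans ?_
        rw [abs_sub_comm]
        exact le_trans (by linarith) (le_abs_self _)
    | succ j ih =>
      intro a b ha hb hga hgb
      obtain ⟨a', ha', b', hb', c, hc, h1, h2, h3⟩ := hsplit j a b ha hb hga hgb
      have hab : 0 ≤ min a b := le_min ha hb
      have ha'0 : 0 ≤ a' := hab.trans ha'.1
      have hb'0 : 0 ≤ b' := hab.trans hb'.1
      have hc0 : 0 ≤ c := (le_min ha'0 hb'0).trans hc.1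
      have e1 := ih c a' hc0 ha'0 h2 h1
      have e2 := ih c b' hc0 hb'0 h2 h3
      have himage : ∀ {s t u}, u ∈ uIcc s t → φ u ∈ uIcc (φ s) (φ t) :=
        fun hu => hmono.image_uIcc_subset ⟨_, hu, rfl⟩
      have e3 : |φ a' - φ b'| ≤ |φ a - φ b| :=
        abs_sub_le_of_uIcc_subset_uIcc (uIcc_subset_uIcc (himage hb') (himage ha')) |>.trans_eq
          (abs_sub_comm _ _)
      have e4 : |φ c - φ a'| + |φ c - φ b'| = |φ a' - φ b'| := by
        rcases mem_uIcc.1 (himage hc) with ⟨h, h'⟩ | ⟨h, h'⟩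
        · rw [abs_of_nonneg (by linarith), abs_of_nonpos (by linarith),
            abs_of_nonpos (by linarith)]
          ring
        · rw [abs_of_nonpos (by linarith), abs_of_nonneg (by linarith),
            abs_of_nonneg (by linarith)]
          ring
      rw [pow_succ]
      linarith
  have hB0 : 0 ≤ B + 1 := by
    obtain ⟨a, b, ha, hb, hga, hgb⟩ := hex 0
    by_contra! h
    exact absurd (hB a (by linarith)) (not_lt.2 hga)
  have hd : 0 < min δ 1 := lt_min hδ one_pos
  obtain ⟨j, hj⟩ := pow_unbounded_of_one_lt ((B + 1) / min δ 1) (one_lt_two : (1 : ℝ) < 2)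
  obtain ⟨a, b, ha, hb, hga, hgb⟩ := hex j
  have h1 := key j a b ha hb hga hgb
  have h2 : |φ a - φ b| ≤ B + 1 := by
    have hφ0 : ∀ t, 0 ≤ t → 0 ≤ φ t ∧ φ t ≤ B + 1 :=
      fun t ht => ⟨le_min ht hB0, min_le_right _ _⟩
    rw [abs_le]
    constructor <;> linarith [(hφ0 a ha).1, (hφ0 a ha).2, (hφ0 b hb).1, (hφ0 b hb).2]
  rw [div_lt_iff₀ hd] at hj
  linarith

/-! ### Riemann maps and geodesics -/

theorem IsRiemannMap.isOpen_image {U V : Set ℂ} {f : ℂ → ℂ} (hf : IsRiemannMap U f)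
    (hU : IsOpen U) (hUc : IsPreconnected U) (hVU : V ⊆ U) (hV : IsOpen V) :
    IsOpen (f '' V) := by
  rcases (hf.1.analyticOnNhd hU).is_constant_or_isOpen hUc with ⟨w, hw⟩ | h
  · obtain ⟨a, ha, ha'⟩ := hf.2.surjOn (show (1 : ℂ) ∈ rightHalfPlane by simp [rightHalfPlane])
    obtain ⟨b, hb, hb'⟩ := hf.2.surjOn (show (2 : ℂ) ∈ rightHalfPlane by simp [rightHalfPlane])
    rw [hw a ha] at ha'
    rw [hw b hb, ha'] at hb'
    norm_num at hb'
  · exact h V hVU hV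

theorem IsRiemannMap.continuousOn_invFunOn {U : Set ℂ} {f : ℂ → ℂ} (hf : IsRiemannMap U f)
    (hU : IsOpen U) (hUc : IsPreconnected U) :
    ContinuousOn (Function.invFunOn f U) rightHalfPlane := by
  have hinv := hf.2.invOn_invFunOn
  refine continuousOn_iff'.2 fun V hV =>
    ⟨f '' (U ∩ V), hf.isOpen_image hU hUc inter_subset_left (hU.inter hV), ?_⟩
  ext w
  constructor
  · rintro ⟨hw, hw'⟩
    exact ⟨⟨_, ⟨hf.2.surjOn.mapsTo_invFunOn hw', hw⟩, hinv.2 hw'⟩, hw'⟩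
  · rintro ⟨⟨z, ⟨hz, hzV⟩, rfl⟩, hw'⟩
    refine ⟨?_, hw'⟩
    rw [mem_preimage, hinv.1 hz]
    exact hzV

/-- Any two points of the half-plane outside the disc of radius `r` around `0` are connected
within this set: first move radially, then along a circular arc. -/
theorem isPreconnected_rightHalfPlane_diff_closedBall {r : ℝ} (hr : 0 ≤ r) :
    IsPreconnected {w : ℂ | w ∈ rightHalfPlane ∧ r < ‖w‖} := by
  have himage : {w : ℂ | w ∈ rightHalfPlane ∧ r < ‖w‖} =
      (fun p : ℝ × ℝ => (p.1 : ℂ) * Complex.exp (p.2 * Complex.I)) ''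
        (Ioi r ×ˢ Ioo (-(Real.pi / 2)) (Real.pi / 2)) := by
    ext w
    constructor
    · rintro ⟨hw, hrw⟩
      exact ⟨(‖w‖, w.arg), ⟨hrw, abs_lt.1 (Complex.abs_arg_lt_pi_div_two_iff.2 (Or.inl hw))⟩,
        Complex.norm_mul_exp_arg_mul_I w⟩
    · rintro ⟨⟨s, θ⟩, ⟨hs, hθ⟩, rfl⟩
      have hs0 : 0 < s := hr.trans_lt hs
      constructor
      · simp only [rightHalfPlane, mem_ofPred_eq, Complex.re_ofReal_mul,
          Complex.exp_ofReal_mul_I_re]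
        exact mul_pos hs0 (Real.cos_pos_of_mem_Ioo hθ)
      · simpa [Complex.norm_exp_ofReal_mul_I, abs_of_pos hs0] using hs
  rw [himage]
  exact (isPreconnected_Ioi.prod isPreconnected_Ioo).image _ (by fun_prop)

/-- Points mapped outside the semicircle of radius `r` lie in an unbounded component of the
complement of the corresponding geodesic. -/
theorem mem_unboundedComponents_diff {T : Set ℂ} {f : ℂ → ℂ} (hT : IsTract T)
    (hf : IsRiemannMap T f) (hinf : FixesInfinity T f) {r : ℝ} (hr : 0 ≤ r) {C : Set ℂ}
    (hC : IsVerticalGeodesic T f r C) {z : ℂ} (hz : z ∈ T) (hrz : r < ‖f z‖) :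
    z ∈ unboundedComponents (T \ C) := by
  set S : Set ℂ := {z | z ∈ T ∧ r < ‖f z‖} with hS
  have hSC : S ⊆ T \ C := fun x hx =>
    ⟨hx.1, fun hxC => hx.2.ne' (hC.2.subset ⟨x, hxC, rfl⟩).2⟩
  have hSconn : IsPreconnected S := by
    have himage : S = Function.invFunOn f T '' {w : ℂ | w ∈ rightHalfPlane ∧ r < ‖w‖} := by
      ext x
      constructor
      · rintro ⟨hx, hrx⟩
        exact ⟨f x, ⟨hf.2.mapsTo hx, hrx⟩, hf.2.invOn_invFunOn.1 hx⟩
      · rintro ⟨w, ⟨hw, hrw⟩, rfl⟩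
        refine ⟨hf.2.surjOn.mapsTo_invFunOn hw, ?_⟩
        rwa [hf.2.invOn_invFunOn.2 hw]
    rw [himage]
    exact (isPreconnected_rightHalfPlane_diff_closedBall hr).image _
      ((hf.continuousOn_invFunOn hT.jordan.1 hT.jordan.2.1.isPreconnected).mono fun w hw => hw.1)
  -- Since `f` tends to ∞ at ∞, `T \ S` is bounded; were `S` bounded too, so would be `T`.
  have hSunb : ¬ IsBounded S := by
    intro hb
    have hev : ∀ᶠ x in cobounded ℂ ⊓ 𝓟 T, r < ‖f x‖ :=
      (tendsto_norm_cobounded_atTop.comp hinf).eventually_gt_atTop r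
    rw [eventually_inf_principal] at hev
    apply hT.unbounded
    have h2 : IsBounded {x | x ∈ T → r < ‖f x‖}ᶜ := isBounded_compl_iff.2 hev
    refine (hb.union h2).subset fun x hx => ?_
    by_cases h : r < ‖f x‖
    · exact Or.inl ⟨hx, h⟩
    · exact Or.inr fun h' => h (h' hx)
  exact ⟨hSC ⟨hz, hrz⟩, fun hb =>
    hSunb (hb.subset (hSconn.subset_connectedComponentIn ⟨hz, hrz⟩ hSC))⟩

/-! ### Translates and iterated curves -/

theorem mem_verticalTranslate {T : Set ℂ} {n : ℤ} {z : ℂ} :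
    z ∈ verticalTranslate T n ↔ z - 2 * Real.pi * Complex.I * n ∈ T := by
  constructor
  · rintro ⟨w, hw, rfl⟩
    simpa using hw
  · intro h
    exact ⟨_, h, by simp⟩

theorem isOpen_verticalTranslate {T : Set ℂ} (hT : IsOpen T) (n : ℤ) :
    IsOpen (verticalTranslate T n) :=
  (Homeomorph.addRight (2 * Real.pi * Complex.I * n)).isOpenMap T hT

theorem re_sub_two_pi_I_mul_int (z : ℂ) (n : ℤ) :
    (z - 2 * Real.pi * Complex.I * n).re = z.re := by simp

theorem continuousOn_periodicExtension {T : Set ℂ} (hT : IsTract T) {f : ℂ → ℂ}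
    (hf : ContinuousOn f T) (n : ℤ) :
    ContinuousOn (periodicExtension T f) (verticalTranslate T n) := by
  have h : ContinuousOn (fun z : ℂ => f (z - 2 * Real.pi * Complex.I * n))
      (verticalTranslate T n) :=
    hf.comp (by fun_prop) fun z hz => mem_verticalTranslate.1 hz
  exact h.congr fun z hz => periodicExtension_eq hT f hz

/-- A connected subset of the union of all translates lies in a single translate. -/
theorem exists_subset_verticalTranslate {T : Set ℂ} (hT : IsTract T) {S : Set ℂ}
    (hS : IsPreconnected S) (hne : S.Nonempty) (hST : S ⊆ allTranslates T) :
    ∃ n : ℤ, S ⊆ verticalTranslate T n := by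
  obtain ⟨z, hz⟩ := hne
  obtain ⟨n, hn⟩ := mem_iUnion.1 (hST hz)
  refine ⟨n, hS.subset_left_of_subset_union (isOpen_verticalTranslate hT.jordan.1 n)
    (isOpen_iUnion fun m : {m : ℤ // m ≠ n} => isOpen_verticalTranslate hT.jordan.1 m.1)
    ?_ ?_ ⟨z, hz, hn⟩⟩
  · refine disjoint_iUnion_right.2 fun m => ?_
    exact (hT.disjoint_closures m.2.symm).mono subset_closure subset_closure
  · intro w hw
    obtain ⟨m, hm⟩ := mem_iUnion.1 (hST hw)
    by_cases h : m = n
    · exact Or.inl (h ▸ hm)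
    · exact Or.inr (mem_iUnion.2 ⟨⟨m, h⟩, hm⟩)

theorem tendsto_periodicExtension {T : Set ℂ} (hT : IsTract T) {f : ℂ → ℂ}
    (hinf : FixesInfinity T f) (n : ℤ) {γ : ℝ → ℂ} (hγ : Tendsto γ atTop (cobounded ℂ))
    (hγT : ∀ t, 0 ≤ t → γ t ∈ verticalTranslate T n) :
    Tendsto (fun t => periodicExtension T f (γ t)) atTop (cobounded ℂ) := by
  have h1 : Tendsto (fun t => γ t - 2 * Real.pi * Complex.I * n) atTop (cobounded ℂ ⊓ 𝓟 T) := by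
    refine tendsto_inf.2 ⟨?_, tendsto_principal.2 ?_⟩
    · rw [← tendsto_norm_atTop_iff_cobounded] at hγ ⊢
      refine tendsto_atTop_mono (fun t => norm_sub_norm_le (γ t) _) ?_
      exact tendsto_atTop_add_const_right _ _ hγ
    · filter_upwards [eventually_ge_atTop 0] with t ht
      exact mem_verticalTranslate.1 (hγT t ht)
  refine (hinf.comp h1).congr' ?_
  filter_upwards [eventually_ge_atTop 0] with t ht
  exact (periodicExtension_eq hT f (hγT t ht)).symm

/-- The iterates of a curve to infinity in the Julia set are curves to infinity, each of them
contained in a single translate of the tract. -/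
theorem iterate_curve {T : Set ℂ} (hT : IsTract T) {f : ℂ → ℂ} (hf : ContinuousOn f T)
    (hinf : FixesInfinity T f) {γ : ℝ → ℂ} (hγ : ContinuousOn γ (Ici 0))
    (hγJ : ∀ t, 0 ≤ t → γ t ∈ juliaSet (allTranslates T) (periodicExtension T f))
    (hγlim : Tendsto γ atTop (cobounded ℂ)) (k : ℕ) :
    ContinuousOn (fun t => (periodicExtension T f)^[k] (γ t)) (Ici 0) ∧
      Tendsto (fun t => (periodicExtension T f)^[k] (γ t)) atTop (cobounded ℂ) ∧
      ∃ n : ℤ, ∀ t, 0 ≤ t → (periodicExtension T f)^[k] (γ t) ∈ verticalTranslate T n := by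
  -- Continuity at stage `k` confines the curve to one translate, which in turn gives continuity at
  -- stage `k + 1`.
  have htrans : ∀ k, ContinuousOn (fun t => (periodicExtension T f)^[k] (γ t)) (Ici 0) →
      ∃ n : ℤ, ∀ t, 0 ≤ t → (periodicExtension T f)^[k] (γ t) ∈ verticalTranslate T n := by
    intro k hk
    obtain ⟨n, hn⟩ := exists_subset_verticalTranslate hT (isPreconnected_Ici.image _ hk)
      (nonempty_Ici.image _) (by rintro _ ⟨t, ht, rfl⟩; exact hγJ t ht k)
    exact ⟨n, fun t ht => hn ⟨t, ht, rfl⟩⟩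
  induction k with
  | zero => exact ⟨hγ, hγlim, htrans 0 hγ⟩
  | succ k ih =>
    obtain ⟨hcont, hlim, n, hn⟩ := ih
    have hcont' : ContinuousOn (fun t => (periodicExtension T f)^[k + 1] (γ t)) (Ici 0) := by
      simp only [Function.iterate_succ_apply']
      exact (continuousOn_periodicExtension hT hf n).comp hcont fun t ht => hn t ht
    refine ⟨hcont', ?_, htrans _ hcont'⟩
    simp only [Function.iterate_succ_apply']
    exact tendsto_periodicExtension hT hinf n hlim hn

/-- Injectivity makes `C` the full preimage of the semicircle in `U`. -/
theorem IsVerticalGeodesic.mem {U : Set ℂ} {f : ℂ → ℂ} (hf : IsRiemannMap U f) {r : ℝ}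
    {C : Set ℂ} (hC : IsVerticalGeodesic U f r C) {z : ℂ} (hz : z ∈ U) (hr : ‖f z‖ = r) :
    z ∈ C := by
  obtain ⟨w, hw, hwz⟩ : f z ∈ f '' C := hC.2.symm ▸ ⟨hf.2.mapsTo hz, hr⟩
  exact hf.2.injOn (hC.1 hw) hz hwz ▸ hw

theorem theorem6p1
    (T : Set ℂ) (hT : IsTract T) (hTH : T ⊆ rightHalfPlane)
    (F₀ : ℂ → ℂ) (hF₀ : IsRiemannMap T F₀) (hinfty : FixesInfinity T F₀)
    (H : ℝ) (hH : H < 2 * Real.pi)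
    (hheight : ∀ z ∈ T, ∀ z' ∈ T, |z.im - z'.im| < H)
    -- The radii are `ρ k`, `ρ' k` for `k ≥ 1`; the values at `k = 0` are not used.
    (ρ ρ' : ℕ → ℝ) (C C' : ℕ → Set ℂ)
    (hpos : 0 < ρ 1)
    (horder : ∀ k, 1 ≤ k → ρ k < ρ' k ∧ ρ' k < ρ (k + 1))
    (hC : ∀ k, IsVerticalGeodesic T F₀ (ρ (k + 1)) (C k))
    (hC' : ∀ k, IsVerticalGeodesic T F₀ (ρ' (k + 1)) (C' k))
    (hgrowth : ∀ k, 1 ≤ k → ρ k + H < ρ' k / 2 ∧ ρ' k + H < ρ (k + 1) / 2)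
    (hre : ∀ k, 1 ≤ k → ∀ z ∈ C k ∪ C' k, ρ' k + H < z.re ∧ z.re < ρ (k + 1) / 2)
    (hback : ∀ k, 1 ≤ k → ∀ z ∈ unboundedComponents (T \ C' k), ρ' k < z.re)
    (hturn : ∀ k, 1 ≤ k → ∀ γ : unitInterval → ℂ, Continuous γ → (∀ t, γ t ∈ T) →
      γ 0 ∈ C k → γ 1 ∈ C' k → ∃ t, (γ t).re = ρ k / 2) :
    ¬ ContainsCurveToInfinity (juliaSet (allTranslates T) (periodicExtension T F₀)) := by
  rintro ⟨γ, hγ, hγJ, hγlim⟩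
  have hH0 : 0 < H := by
    obtain ⟨z, hz⟩ := hT.jordan.2.1.nonempty
    simpa using hheight z hz z hz
  have hρpos : ∀ k, 0 < ρ (k + 1) := by
    intro k
    induction k with
    | zero => exact hpos
    | succ k ih => linarith [horder (k + 1) (by omega)]
  have hρlarge : ∀ k : ℕ, k * H ≤ ρ (k + 1) := by
    intro k
    induction k with
    | zero => simpa using hpos.le
    | succ k ih =>
      push_cast
      linarith [hρpos k, horder (k + 1) (by omega), hgrowth (k + 1) (by omega)]
  obtain ⟨m, hm1, hm⟩ : ∃ m, 1 ≤ m ∧ ‖γ 0‖ ≤ ρ' m := by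
    obtain ⟨k, hk⟩ := exists_nat_ge (‖γ 0‖ / H)
    rw [div_le_iff₀ hH0] at hk
    exact ⟨k + 1, by omega, by linarith [hρlarge k, horder (k + 1) (by omega)]⟩
  have hiter := iterate_curve hT hF₀.1.continuousOn hinfty hγ hγJ hγlim
  set Γ : ℕ → ℝ → ℂ := fun k t => (periodicExtension T F₀)^[k] (γ t) with hΓ
  choose hcont hlim n hn using hiter
  have hnT : ∀ k t, 0 ≤ t → Γ k t - 2 * Real.pi * Complex.I * n k ∈ T :=
    fun k t ht => mem_verticalTranslate.1 (hn k t ht)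
  have hsucc : ∀ k t, 0 ≤ t → Γ (k + 1) t = F₀ (Γ k t - 2 * Real.pi * Complex.I * n k) := by
    intro k t ht
    rw [← periodicExtension_eq hT F₀ (hn k t ht)]
    exact Function.iterate_succ_apply' _ _ _
  -- If the bound failed at `k + 1`, the translate of `Γ k 0` would lie beyond `C' (m + k)`, forcing
  -- its real part above `ρ' (m + k)`.
  have hstart : ∀ k, ‖Γ k 0‖ ≤ ρ' (m + k) := by
    intro k
    induction k with
    | zero => exact hm
    | succ k ih =>
      by_contra! h
      rw [hsucc k 0 le_rfl] at h
      have hr : 0 ≤ ρ' (m + k + 1) := by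
        linarith [hρpos (m + k), horder (m + k + 1) (by omega)]
      have h1 := hback (m + k) (by omega) _
        (mem_unboundedComponents_diff hT hF₀ hinfty hr (hC' (m + k)) (hnT k 0 le_rfl) h)
      rw [re_sub_two_pi_I_mul_int] at h1
      linarith [Complex.re_le_norm (Γ k 0)]
  -- The index `n k` is uncontrolled, so heights are compared with that of `Γ k 0`, in the same
  -- translate.
  have him : ∀ k t, 0 ≤ t → |(Γ k t).im| ≤ ρ' (m + k) + H := by
    intro k t ht
    have h1 := hheight _ (hnT k t ht) _ (hnT k 0 le_rfl)
    rw [Complex.sub_im, Complex.sub_im, sub_sub_sub_cancel_right] at h1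
    linarith [abs_sub_abs_le_abs_sub (Γ k t).im (Γ k 0).im, Complex.abs_im_le_norm (Γ k 0),
      hstart k]
  refine false_of_doubling_crossings (fun k t => ‖Γ k t‖) (fun k => ρ (m + k + 1))
    (fun k => ρ' (m + k + 1)) (horder _ (by omega)).1 (hcont 0).norm
    (tendsto_norm_cobounded_atTop.comp (hlim 0)) ?_ ?_
  · intro j
    obtain ⟨b, hb, hb0⟩ := (((tendsto_norm_cobounded_atTop.comp (hlim j)).eventually_ge_atTop
      (ρ' (m + j + 1))).and (eventually_ge_atTop 0)).exists
    exact ⟨0, b, le_rfl, hb0, by linarith [hstart j, horder (m + j) (by omega)], hb⟩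
  · intro j a b ha hb hga hgb
    have hsub : ∀ {s t u : ℝ}, 0 ≤ s → 0 ≤ t → u ∈ uIcc s t → 0 ≤ u :=
      fun hs ht hu => (le_min hs ht).trans hu.1
    have hρρ' := (horder (m + (j + 1) + 1) (by omega)).1
    have hivt := intermediate_value_uIcc ((hcont (j + 1)).norm.mono
      fun u (hu : u ∈ uIcc a b) => hsub ha hb hu)
    obtain ⟨a', ha', hga'⟩ := hivt (mem_uIcc.2 (Or.inl ⟨hga, hρρ'.le.trans hgb⟩))
    obtain ⟨b', hb', hgb'⟩ := hivt (mem_uIcc.2 (Or.inl ⟨hga.trans hρρ'.le, hgb⟩))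
    have ha'0 := hsub ha hb ha'
    have hb'0 := hsub ha hb hb'
    have haC : Γ j a' - 2 * Real.pi * Complex.I * n j ∈ C (m + j + 1) := by
      refine (hC (m + j + 1)).mem hF₀ (hnT j a' ha'0) ?_
      rw [← hsucc j a' ha'0]
      exact hga'
    have hbC : Γ j b' - 2 * Real.pi * Complex.I * n j ∈ C' (m + j + 1) := by
      refine (hC' (m + j + 1)).mem hF₀ (hnT j b' hb'0) ?_
      rw [← hsucc j b' hb'0]
      exact hgb'
    have hseg : ∀ s : unitInterval, AffineMap.lineMap a' b' (s : ℝ) ∈ uIcc a' b' := by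
      intro s
      rw [← segment_eq_uIcc, segment_eq_image_lineMap]
      exact ⟨s, s.2, rfl⟩
    obtain ⟨s, hs⟩ := hturn (m + j + 1) (by omega)
      (fun s => Γ j (AffineMap.lineMap a' b' (s : ℝ)) - 2 * Real.pi * Complex.I * n j)
      (((hcont j).comp_continuous
        (AffineMap.lineMap_continuous.comp continuous_subtype_val)
        fun s => hsub ha'0 hb'0 (hseg s)).sub continuous_const)
      (fun s => hnT j _ (hsub ha'0 hb'0 (hseg s))) (by simpa using haC) (by simpa using hbC)
    have h1 := (hre (m + j + 1) (by omega) _ (Or.inl haC)).1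
    have h2 := (hre (m + j + 1) (by omega) _ (Or.inr hbC)).1
    rw [re_sub_two_pi_I_mul_int] at hs h1 h2
    refine ⟨a', ha', b', hb', _, hseg s, ?_, ?_, ?_⟩
    · linarith [Complex.re_le_norm (Γ j a')]
    -- The real part contributes `ρ (m + j + 1) / 2`, and the imaginary part at most `ρ' (m + j) +
    -- H`, which is smaller than that by `hgrowth`.
    · have h3 := Complex.norm_le_abs_re_add_abs_im (Γ j (AffineMap.lineMap a' b' (s : ℝ)))
      rw [hs, abs_of_pos (half_pos (hρpos (m + j)))] at h3
      linarith [him j _ (hsub ha'0 hb'0 (hseg s)), hgrowth (m + j) (by omega)]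
    · linarith [Complex.re_le_norm (Γ j b')]
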